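/- Let $n,r\ge 1$ be integers, and put $s=(2r,3r,\dots,nr)$ (a sequence of length $n-1$, empty if $n=1$) and $\mu=(r,2r,\dots,nr)$. For a sequence $t=(t_1,\dots,t_m)$ of positive integers, $m \ge 0$, let $P_m^t=\{x\in\mathbb{R}^m : 0\le \frac{x_1}{t_1}\le\cdots\le\frac{x_m}{t_m}\le 1\}$ be the $t$-lecture hall simplex, with vertices $v_0,\dots,v_m$. The $t$-derangement polynomial is its box polynomial (local $h^*$-polynomial) $$d_m^t(z)=\sum_{(x_1,\dots,x_{m+1})\in\Pi^\circ\cap\mathbb{Z}^{m+1}}z^{x_{m+1}},\qquad \Pi^\circ=\Big\{\sum_{i=0}^m\lambda_i(v_i,1) : 0<\lambda_i<1\Big\}.$$ Let $d_{n,r}(z)=\sum_{(\pi,c)}z^{\mathrm{exc}(\pi,c)}$ be the $r$-colored derangement polynomial. Here the sum is over all pairs of a permutation $\pi$ of $\{1,\dots,n\}$ and a vector $c\in\{0,\dots,r-1\}^n$ for which no $i$ satisfies both $\pi_i=i$ and $c_i=0$, and $\mathrm{exc}(\pi,c)$ is the number of $i$ such that $\pi_i>i$, or $\pi_i=i$ and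 $c_i>0$. Then $$d_{n-1}^s(z)+d_n^\mu(z)=d_{n,r}(z).$$ Moreover, this is the symmetric ($\mathcal{I}_n$-)decomposition of $d_{n,r}$: the polynomial $d_n^\mu$ is divisible by $z$, and $(a,b)=(d_{n-1}^s,\ d_n^\mu/z)$ is the unique pair of real polynomials with $d_{n,r}(z)=a(z)+z\,b(z)$, $\deg a\le n$, $\deg b\le n-1$, $a(z)=z^n a(1/z)$ and $b(z)=z^{n-1}b(1/z)$. -/

import Mathlib

open Polynomial

noncomputable section

/-- The open parallelepiped of a polytope `P ⊆ ℝⁿ` (used for simplices): all combinations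
`∑ λ_v (v, 1)` over the vertices `v` of `P` with `0 < λ_v < 1`.  The vertices of `P` are its
extreme points, and `ℝⁿ⁺¹` is written as `ℝⁿ × ℝ`. -/
def openParallelepiped {n : ℕ} (P : Set (Fin n → ℝ)) : Set ((Fin n → ℝ) × ℝ) :=
  {p | ∃ c : (Fin n → ℝ) → ℝ, (∀ v ∈ P.extremePoints ℝ, 0 < c v ∧ c v < 1) ∧
    p = ∑ᶠ v ∈ P.extremePoints ℝ, c v • (v, (1 : ℝ))}

/-- The integer points of the open parallelepiped of `P`, as elements of `ℤⁿ × ℤ`. -/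
def boxPoints {n : ℕ} (P : Set (Fin n → ℝ)) : Set ((Fin n → ℤ) × ℤ) :=
  {x | ((fun i => (x.1 i : ℝ)), (x.2 : ℝ)) ∈ openParallelepiped P}

/-- The box polynomial (local `h^*`-polynomial) of a lattice simplex `P`: the integer points of
its open parallelepiped, counted by their last coordinate (which is never negative). -/
def boxPolynomial {n : ℕ} (P : Set (Fin n → ℝ)) : ℝ[X] :=
  ∑ᶠ x ∈ boxPoints P, (X : ℝ[X]) ^ x.2.toNat

/-- The `s`-lecture hall simplex `0 ≤ x₁/s₁ ≤ ⋯ ≤ xₙ/sₙ ≤ 1` of a sequence `s` of positive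
integers. -/
def lectureHallSimplex {n : ℕ} (s : Fin n → ℕ) : Set (Fin n → ℝ) :=
  {x | (∀ i, 0 ≤ x i / (s i : ℝ)) ∧ (∀ i j, i ≤ j → x i / (s i : ℝ) ≤ x j / (s j : ℝ)) ∧
    ∀ i, x i / (s i : ℝ) ≤ 1}

/-- The `s`-derangement polynomial `d_n^s(z)`. -/
def sDerangementPolynomial {n : ℕ} (s : Fin n → ℕ) : ℝ[X] :=
  boxPolynomial (lectureHallSimplex s)

/-- `r`-colored permutations of length `n`: pairs `(π, c)`, where `c i` is the color of `π i`. -/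
abbrev ColoredPerm (n r : ℕ) : Type := Equiv.Perm (Fin n) × (Fin n → Fin r)

/-- The index `i` is an excedance of `(π, c)`. -/
def ColoredPerm.IsExcedance {n r : ℕ} (σ : ColoredPerm n r) (i : Fin n) : Prop :=
  i < σ.1 i ∨ (σ.1 i = i ∧ 0 < (σ.2 i : ℕ))

/-- `(π, c)` has no fixed points of color `0`. -/
def ColoredPerm.IsDerangement {n r : ℕ} (σ : ColoredPerm n r) : Prop :=
  ∀ i, ¬ (σ.1 i = i ∧ (σ.2 i : ℕ) = 0)

open Classical in
/-- The number of excedances of `(π, c)`. -/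
def ColoredPerm.exc {n r : ℕ} (σ : ColoredPerm n r) : ℕ :=
  (Finset.univ.filter fun i => σ.IsExcedance i).card

open Classical in
/-- The `r`-colored derangement polynomial `d_{n,r}(z)`. -/
def coloredDerangementPolynomial (n r : ℕ) : ℝ[X] :=
  ∑ σ ∈ Finset.univ.filter (fun σ : ColoredPerm n r => σ.IsDerangement), (X : ℝ[X]) ^ σ.exc

/-- `(a, b)` is a symmetric decomposition of `p` with respect to degree `d`:
`p(z) = a(z) + z b(z)` with `deg a ≤ d`, `deg b ≤ d - 1`, `a(z) = z^d a(1/z)` and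
`b(z) = z^(d-1) b(1/z)` (so `b = 0` if `d = 0`). -/
structure IsSymmetricDecomposition (d : ℕ) (p a b : ℝ[X]) : Prop where
  eq_add : p = a + X * b
  degree_left : a.degree ≤ d
  degree_right : b.degree < d
  symm_left : a.reflect d = a
  symm_right : b.reflect (d - 1) = b

end

/-! All three polynomials are reduced to ascent enumerators of inversion sequences without plateaus,
meaning that consecutive ratios `e_k / t_k` differ, with a zero placed at both ends.

Box points: in the basis of lifted vertices, the coordinates of `(x, h)` are the consecutive
differences of `0, x₁/s₁, …, xₘ/sₘ, h`, so a box point is an integer chain whose gaps lie strictly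
in `(0, 1)`. Writing each entry as `q * t - e` with `0 ≤ e < t`, the gap condition forces `q` to
grow by one at an ascent of the residues `e`, to stay constant at a descent, and forbids plateaus.
Hence `h` is the number of ascents (`exists_residue_of_gap`, `finite_chainSet_and_ncard`).

Gluing: plateau-free sequences for `(r, …, nr)` with nonzero first entry give `d_n^μ`. If the first
entry may vanish, the extra sequences lose their leading zero and give `d_{n-1}^s`. The sum is
therefore `plateauFreePolynomial r n 0`.

Comparison: this polynomial and the permanent form of `d_{n,r}` both have the expansion `(1 - X) ∑ₘ
X^m ((1 - X) r m - X)^n`. For the permanent this follows from a differential recurrence; for the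
sequences, from an explicit expansion for every last entry, stable under the transfer recurrence.
Power series are replaced by congruences modulo every `X ^ M`.

The symmetries come from the reflection `λ ↦ 1 - λ` of the parallelepiped. -/

noncomputable section

/-! ### The colored derangement polynomial as a permanent, and its recurrence -/

/-- The total weight, over all colors, of the value `j` at the index `i` of a colored derangement
with `r` colors. -/
def derangementWeight (r : ℕ) {n : ℕ} (i j : Fin n) : ℝ[X] :=
  if i < j then (r : ℝ[X]) * X else if j < i then (r : ℝ[X]) else ((r : ℝ[X]) - 1) * X

open Classical in
-- For a fixed permutation the colors are independent, so the sum over color vectors factors; the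
-- forbidden color at a fixed point has weight 0.
theorem coloredDerangementPolynomial_eq_sum_prod (n r : ℕ) (hr : 1 ≤ r) :
    coloredDerangementPolynomial n r =
      ∑ σ : Equiv.Perm (Fin n), ∏ i, derangementWeight r i (σ i) := by
  obtain ⟨r, rfl⟩ : ∃ k, r = k + 1 := ⟨r - 1, by omega⟩
  set w : Fin n → Fin n → Fin (r + 1) → ℝ[X] := fun i j c =>
    if j = i ∧ (c : ℕ) = 0 then 0 else if i < j ∨ (j = i ∧ 0 < (c : ℕ)) then X else 1 with hw
  have hsum : ∀ i j, derangementWeight (r + 1) i j = ∑ c, w i j c := by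
    intro i j
    rcases lt_trichotomy i j with h | h | h
    · simp [derangementWeight, hw, h, h.ne']
    · subst h
      simp [derangementWeight, hw, Fin.sum_univ_succ]
    · simp [derangementWeight, hw, h, h.ne, h.not_gt]
  simp_rw [hsum, Finset.prod_univ_sum, coloredDerangementPolynomial, Finset.sum_filter,
    Fintype.sum_prod_type, Fintype.piFinset_univ]
  refine Finset.sum_congr rfl fun σ _ => Finset.sum_congr rfl fun c _ => ?_
  split_ifs with h
  · rw [ColoredPerm.exc, ← Finset.prod_const, Finset.prod_filter]
    refine Finset.prod_congr rfl fun i _ => ?_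
    have := h i
    simp only at this
    simp only [hw, this, if_false, ColoredPerm.IsExcedance]
    congr
  · simp only [ColoredPerm.IsDerangement, not_forall, not_not] at h
    obtain ⟨i, hi⟩ := h
    exact (Finset.prod_eq_zero (Finset.mem_univ i) (by simp only [hw, hi, and_self, if_true])).symm

theorem derangementWeight_succ_succ (r : ℕ) {n : ℕ} (i j : Fin n) :
    derangementWeight r i.succ j.succ = derangementWeight r i j := by
  simp [derangementWeight]

theorem derangementWeight_succAbove (r : ℕ) {n : ℕ} (k : Fin (n + 1)) (i j : Fin n) :
    derangementWeight r (k.succAbove i) (k.succAbove j) = derangementWeight r i j := by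
  simp [derangementWeight]

/-- The `r`-colored derangement polynomial as a permanent. -/
def derangementPermanent (r n : ℕ) : ℝ[X] :=
  ∑ σ : Equiv.Perm (Fin n), ∏ i, derangementWeight r i (σ i)

/-- Delete the index 0 from its cycle. Either 0 is fixed, or it sits between some `k` and its image;
then the arrow out of 0 is an excedance, the arrow into 0 is not, and together they replace the
factor at `k`. -/
theorem derangementPermanent_succ_eq_sum_erase (r n : ℕ) :
    derangementPermanent r (n + 1) = ((r : ℝ[X]) - 1) * X * derangementPermanent r n +
      ∑ σ : Equiv.Perm (Fin n), ∑ k, (r : ℝ[X]) * X * (r : ℝ[X]) *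
        ∏ i ∈ Finset.univ.erase k, derangementWeight r i (σ i) := by
  rw [derangementPermanent, ← Equiv.sum_comp Equiv.Perm.decomposeFin.symm,
    Fintype.sum_prod_type_right, derangementPermanent, Finset.mul_sum, ← Finset.sum_add_distrib]
  refine Finset.sum_congr rfl fun e _ => ?_
  rw [Fin.sum_univ_succ]
  congr 1
  · rw [Fin.prod_univ_succ]
    simp [derangementWeight]
  -- The nonzero image of 0 is parametrized as `(e k).succ`, so that 0 is inserted between `k` and
  -- `e k`.
  · rw [← Equiv.sum_comp e]
    refine Finset.sum_congr rfl fun k _ => ?_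
    have hk : derangementWeight r 0 (Equiv.Perm.decomposeFin.symm ((e k).succ, e) 0) *
        derangementWeight r k.succ (Equiv.Perm.decomposeFin.symm ((e k).succ, e) k.succ) =
        (r : ℝ[X]) * X * (r : ℝ[X]) := by
      rw [Equiv.Perm.decomposeFin_symm_apply_zero, Equiv.Perm.decomposeFin_symm_apply_succ,
        Equiv.swap_apply_right]
      simp [derangementWeight]
    rw [Fin.prod_univ_succ, ← Finset.mul_prod_erase _ _ (Finset.mem_univ k), ← mul_assoc, hk]
    refine congrArg _ (Finset.prod_congr rfl fun i hi => ?_)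
    have hne : e i ≠ e k := fun h => Finset.ne_of_mem_erase hi (e.injective h)
    rw [Equiv.Perm.decomposeFin_symm_apply_succ, Equiv.swap_apply_of_ne_of_ne
      (Fin.succ_ne_zero _) (by simpa using hne), derangementWeight_succ_succ]

theorem sum_fixing_eq_derangementPermanent (r n : ℕ) (k : Fin (n + 1)) :
    ∑ σ : Equiv.Perm (Fin (n + 1)), (if σ k = k then
      ∏ i ∈ Finset.univ.erase k, derangementWeight r i (σ i) else 0) =
      derangementPermanent r n := by
  rw [← Equiv.sum_comp (Equiv.Perm.decomposeOption.symm.trans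
    (finSuccEquiv' k).symm.permCongr), Fintype.sum_prod_type, Fintype.sum_option,
    derangementPermanent]
  have hzero : ∀ a : Fin n, ∀ e : Equiv.Perm (Fin n), ¬ ((Equiv.Perm.decomposeOption.symm.trans
    (finSuccEquiv' k).symm.permCongr) (some a, e)) k = k := by
    intro a e
    simp [Equiv.permCongr_apply]
  simp only [hzero, if_false, Finset.sum_const_zero, add_zero]
  refine Finset.sum_congr rfl fun e _ => ?_
  rw [if_pos (by simp [Equiv.permCongr_apply])]
  have herase : (Finset.univ.erase k) = Finset.univ.map (Fin.succAboveEmb k) := by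
    ext i
    simp [Fin.exists_succAbove_eq_iff]
  rw [herase, Finset.prod_map]
  refine Finset.prod_congr rfl fun i _ => ?_
  rw [← derangementWeight_succAbove r k]
  simp [Equiv.permCongr_apply]

/-- Expresses the weight of the two arrows through an inserted index by the deleted factor and its
derivative, uniformly in the three cases up to a correction at fixed points. Summed over the
insertion place, the derivative terms form the derivative of the whole product by the Leibniz rule.
-/
theorem derangementWeight_identity (r : ℕ) {n : ℕ} (i j : Fin n) :
    (r : ℝ[X]) * X * (r : ℝ[X]) = (r : ℝ[X]) * (X * (1 - X) * derivative (derangementWeight r i j) +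
      X * derangementWeight r i j + if j = i then X else 0) := by
  rcases lt_trichotomy i j with h | h | h
  · simp [derangementWeight, h, h.ne']; ring
  · subst h
    simp [derangementWeight]; ring
  · simp [derangementWeight, h, h.ne, h.not_gt]; ring

theorem derangementPermanent_succ (r n : ℕ) :
    derangementPermanent r (n + 1) = (((r : ℝ[X]) - 1) * X + (r : ℝ[X]) * (n : ℝ[X]) * X) * derangementPermanent r n +
      (r : ℝ[X]) * X * (1 - X) * derivative (derangementPermanent r n) +
      (r : ℝ[X]) * (n : ℝ[X]) * X * derangementPermanent r (n - 1) := by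
  have h1 : ∀ σ : Equiv.Perm (Fin n), ∑ k, (r : ℝ[X]) * X * (r : ℝ[X]) *
      ∏ i ∈ Finset.univ.erase k, derangementWeight r i (σ i) =
      (r : ℝ[X]) * X * (1 - X) * derivative (∏ i, derangementWeight r i (σ i)) +
      (r : ℝ[X]) * (n : ℝ[X]) * X * (∏ i, derangementWeight r i (σ i)) +
      (r : ℝ[X]) * X * ∑ k, if σ k = k then
        ∏ i ∈ Finset.univ.erase k, derangementWeight r i (σ i) else 0 := by
    intro σ
    have hcard : (r : ℝ[X]) * (n : ℝ[X]) * X * (∏ i, derangementWeight r i (σ i)) = ∑ k : Fin n,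
        (r : ℝ[X]) * X * (∏ i, derangementWeight r i (σ i)) := by
      simp; ring
    rw [derivative_prod_finset, hcard, Finset.mul_sum, Finset.mul_sum, ← Finset.sum_add_distrib,
      ← Finset.sum_add_distrib]
    refine Finset.sum_congr rfl fun k _ => ?_
    rw [derangementWeight_identity r k (σ k), ← Finset.mul_prod_erase _ _ (Finset.mem_univ k)]
    split_ifs <;> ring
  rw [derangementPermanent_succ_eq_sum_erase]
  simp_rw [h1]
  rw [Finset.sum_add_distrib, Finset.sum_add_distrib, ← Finset.mul_sum, ← Finset.mul_sum,
    ← Finset.mul_sum, ← derivative_sum, Finset.sum_comm]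
  have h2 : ∑ k : Fin n, ∑ σ : Equiv.Perm (Fin n), (if σ k = k then
        ∏ i ∈ Finset.univ.erase k, derangementWeight r i (σ i) else 0) =
      (n : ℝ[X]) * derangementPermanent r (n - 1) := by
    cases n with
    | zero => simp
    | succ n => simp [sum_fixing_eq_derangementPermanent]
  rw [h2]
  simp only [derangementPermanent]
  ring

/-! ### Power series expansion of the permanent -/

/-- The first `M` terms of the power series expansion of the colored derangement polynomial. -/
def derangementSeries (r n M : ℕ) : ℝ[X] :=
  (1 - X) * ∑ m ∈ Finset.range M, X ^ m * ((1 - X) * ((r : ℝ[X]) * (m : ℝ[X])) - X) ^ n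

/-- The recurrence of the permanent holds term by term in `m`, so truncation creates no boundary
terms. -/
theorem derangementSeries_succ (r n M : ℕ) :
    derangementSeries r (n + 1) M = (((r : ℝ[X]) - 1) * X + (r : ℝ[X]) * (n : ℝ[X]) * X) * derangementSeries r n M +
      (r : ℝ[X]) * X * (1 - X) * derivative (derangementSeries r n M) +
      (r : ℝ[X]) * (n : ℝ[X]) * X * derangementSeries r (n - 1) M := by
  simp only [derangementSeries, Finset.mul_sum, derivative_sum, ← Finset.sum_add_distrib]
  refine Finset.sum_congr rfl fun m _ => ?_
  have hm : (X : ℝ[X]) * derivative (X ^ m : ℝ[X]) = (m : ℝ[X]) * X ^ m := by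
    cases m with
    | zero => simp
    | succ m => simp only [derivative_X_pow, map_natCast, Nat.add_sub_cancel]; ring
  have hn : (n : ℝ[X]) * ((1 - X) * ((r : ℝ[X]) * (m : ℝ[X])) - X) ^ n =
      (n : ℝ[X]) * (((1 - X) * ((r : ℝ[X]) * (m : ℝ[X])) - X) ^ (n - 1) * ((1 - X) * ((r : ℝ[X]) * (m : ℝ[X])) - X)) := by
    cases n with
    | zero => simp
    | succ n => simp [pow_succ]
  simp only [derivative_mul, derivative_sub, derivative_pow, derivative_X, derivative_one,
    derivative_natCast, map_natCast] at hm ⊢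
  linear_combination (-(r : ℝ[X]) * (1 - X) ^ 2 * ((1 - X) * ((r : ℝ[X]) * (m : ℝ[X])) - X) ^ n) * hm
    + (-(r : ℝ[X]) * X * (1 - X) * X ^ m ) * hn

/-- The derivative alone loses a power of `X`; the factor `X` in the recurrence restores it, so
congruences modulo `X ^ M` survive. -/
theorem X_pow_dvd_X_mul_derivative {R : Type*} [CommRing R] {M : ℕ} {p : R[X]} (h : X ^ M ∣ p) :
    X ^ M ∣ X * derivative p := by
  obtain ⟨q, rfl⟩ := h
  cases M with
  | zero => simp
  | succ M =>
    refine ⟨(M + 1 : R[X]) * q + X * derivative q, ?_⟩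
    simp only [derivative_mul, derivative_X_pow, Nat.add_sub_cancel, map_natCast]
    push_cast
    ring

theorem X_pow_dvd_derangementPermanent_sub (r n M : ℕ) :
    X ^ M ∣ derangementPermanent r n - derangementSeries r n M := by
  induction n using Nat.strong_induction_on with
  | _ n ih =>
    cases n with
    | zero =>
      refine ⟨1, ?_⟩
      have := mul_neg_geom_sum (X : ℝ[X]) M
      simp [derangementPermanent, derangementSeries, this]
    | succ n =>
      rw [derangementPermanent_succ, derangementSeries_succ]
      have h1 := ih n n.lt_succ_self
      have h2 := ih (n - 1) (by omega)
      have h3 := X_pow_dvd_X_mul_derivative h1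
      rw [derivative_sub] at h3
      convert ((h1.mul_left ((((r : ℝ[X]) - 1) * X + (r : ℝ[X]) * (n : ℝ[X]) * X))).add
        (h3.mul_left ((r : ℝ[X]) * (1 - X)))).add (h2.mul_left ((r : ℝ[X]) * (n : ℝ[X]) * X)) using 1
      ring

/-! ### Plateau-free inversion sequences and their transfer recurrence -/

/-- The weight of consecutive entries `i / t` and `j / t'`: `X` for an ascent, `1` for a descent and
`0` for a plateau. -/
def ascentWeight (i t j t' : ℕ) : ℝ[X] :=
  if i * t' < j * t then X else if j * t < i * t' then 1 else 0

/-- The ascent enumerator of inversion sequences for `(r, 2r, …, (n + 1)r)` without plateaus that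
end in `j`; they may start with `0`. -/
def plateauFreePolynomial (r : ℕ) : ℕ → ℕ → ℝ[X]
  | 0, j => if j = 0 then 1 else X
  | n + 1, j => ∑ i ∈ Finset.range ((n + 1) * r),
      ascentWeight i ((n + 1) * r) j ((n + 2) * r) * plateauFreePolynomial r n i

/-- For `j = (n + 2) * a + b`, the threshold `(n + 1) * j / (n + 2)` is `(n + 1) * a + b - b / (n +
2)`: the integers below it are those below `(n + 1) * a + b`, and it is an integer only for `b = 0`.
-/
theorem ascentWeight_consecutive {r : ℕ} (hr : 1 ≤ r) {n a b : ℕ} (hb : b ≤ n + 1) (i : ℕ) :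
    ascentWeight i ((n + 1) * r) ((n + 2) * a + b) ((n + 2) * r) =
      1 - (1 - X) * (if i < (n + 1) * a + b then 1 else 0) -
        (if b = 0 ∧ i = (n + 1) * a then 1 else 0) := by
  have e1 : i * ((n + 2) * r) = i * (n + 2) * r := by ring
  have e2 : ((n + 2) * a + b) * ((n + 1) * r) = ((n + 2) * a + b) * (n + 1) * r := by ring
  rw [ascentWeight, e1, e2]
  simp only [Nat.mul_lt_mul_right hr]
  rcases lt_trichotomy i ((n + 1) * a + b) with h | h | h
  · have : i * (n + 2) < ((n + 2) * a + b) * (n + 1) := by nlinarith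
    have h' : ¬ (b = 0 ∧ i = (n + 1) * a) := by rintro ⟨rfl, rfl⟩; omega
    simp [this, h, h']
  · rcases Nat.eq_zero_or_pos b with rfl | hb0
    · subst h
      have : ((n + 1) * a + 0) * (n + 2) = ((n + 2) * a + 0) * (n + 1) := by ring
      rw [if_neg this.not_lt, if_neg this.symm.not_lt]
      simp
    · have h1 : ((n + 2) * a + b) * (n + 1) < i * (n + 2) := by subst h; nlinarith
      rw [if_neg h1.not_gt, if_pos h1]
      simp [h, hb0.ne']
  · have h1 : ((n + 2) * a + b) * (n + 1) < i * (n + 2) := by nlinarith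
    have h' : ¬ (b = 0 ∧ i = (n + 1) * a) := by rintro ⟨rfl, rfl⟩; omega
    simp [h1, h1.not_gt, h.not_gt, h']

theorem plateauFreePolynomial_succ {r : ℕ} (hr : 1 ≤ r) {n a b : ℕ} (ha : a < r)
    (hb : b ≤ n + 1) :
    plateauFreePolynomial r (n + 1) ((n + 2) * a + b) =
      ∑ i ∈ Finset.range ((n + 1) * r), plateauFreePolynomial r n i -
      (1 - X) * ∑ i ∈ Finset.range ((n + 1) * a + b), plateauFreePolynomial r n i -
      if b = 0 then plateauFreePolynomial r n ((n + 1) * a) else 0 := by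
  have hle : (n + 1) * a + b ≤ (n + 1) * r := by nlinarith
  have hlt : (n + 1) * a < (n + 1) * r := by nlinarith
  simp only [plateauFreePolynomial, ascentWeight_consecutive hr hb, sub_mul, one_mul,
    Finset.sum_sub_distrib, mul_assoc, ite_mul, zero_mul]
  congr 1
  · congr 1
    have hfilter : ∑ i ∈ Finset.range ((n + 1) * r),
        (if i < (n + 1) * a + b then plateauFreePolynomial r n i else 0) =
        ∑ i ∈ Finset.range ((n + 1) * a + b), plateauFreePolynomial r n i := by
      rw [← Finset.sum_filter]
      congr 1
      ext i
      simp only [Finset.mem_filter, Finset.mem_range]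
      omega
    rw [← Finset.mul_sum, hfilter]
  · split_ifs with h
    · simp [h, hlt]
    · simp [h]

/-! ### Closed form for every last entry -/

/-- Coefficients of the power series expansion of `plateauFreePolynomial r n ((n + 1) * a + b)`. -/
def plateauFreeTerm (r n a b m : ℕ) : ℝ[X] :=
  if a = 0 ∨ 1 ≤ m then
    if b = 0 then ((1 - X) * ((r : ℝ[X]) * (m : ℝ[X]) - (a : ℝ[X])) - X) ^ n
    else (1 - X) * ((r : ℝ[X]) * (m : ℝ[X]) - (a : ℝ[X])) *
      ((1 - X) * ((r : ℝ[X]) * (m : ℝ[X]) - (a : ℝ[X])) - 1) ^ (b - 1) *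
      ((1 - X) * ((r : ℝ[X]) * (m : ℝ[X]) - (a : ℝ[X])) - X) ^ (n - b)
  else 0

/-- Antidifferences of `plateauFreeTerm`. -/
def plateauFreeSumTerm (r n a b m : ℕ) : ℝ[X] :=
  if a = 0 ∨ 1 ≤ m then
    if b = 0 then (1 - X) * ((r : ℝ[X]) * (m : ℝ[X]) - (a : ℝ[X]) + 1) *
      ((1 - X) * ((r : ℝ[X]) * (m : ℝ[X]) - (a : ℝ[X])) - X) ^ n
    else (1 - X) * ((r : ℝ[X]) * (m : ℝ[X]) - (a : ℝ[X])) *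
      ((1 - X) * ((r : ℝ[X]) * (m : ℝ[X]) - (a : ℝ[X])) - 1) ^ (b - 1) *
      ((1 - X) * ((r : ℝ[X]) * (m : ℝ[X]) - (a : ℝ[X])) - X) ^ (n + 1 - b)
  else 0

/-- With `u = (1 - X) * (r * m - a)`, this is `(u - X) - (u - 1) = 1 - X` for `b > 0`, and `(u + 1 -
X) - u = 1 - X` for `b = 0`, times the common factors. It makes the partial sums over last entries
telescope. -/
theorem plateauFreeSumTerm_sub (r n a m : ℕ) {b : ℕ} (hb : b ≤ n) :
    plateauFreeSumTerm r n a b m - plateauFreeSumTerm r n a (b + 1) m =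
      (1 - X) * plateauFreeTerm r n a b m := by
  unfold plateauFreeSumTerm plateauFreeTerm
  simp only [Nat.add_eq_zero_iff, one_ne_zero, and_false, if_false, Nat.add_sub_cancel]
  by_cases h1 : a = 0 ∨ 1 ≤ m
  · simp only [h1, if_true]
    rcases Nat.eq_zero_or_pos b with rfl | hb0
    · simp only [if_true, pow_zero, zero_add, Nat.add_sub_cancel]
      ring
    · obtain ⟨c, rfl⟩ : ∃ c, b = c + 1 := ⟨b - 1, by omega⟩
      have e : n + 1 - (c + 1) = (n - (c + 1)) + 1 := by omega
      have e' : n + 1 - (c + 1 + 1) = n - (c + 1) := by omega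
      rw [if_neg hb0.ne', if_neg hb0.ne', e, e', Nat.add_sub_cancel]
      ring
  · simp only [h1, if_false]
    ring

/-- The carry from `b = n + 1` to the next block: raising `a` by one lowers `u` by `1 - X`, and both
sides become `u * (u - 1) ^ n`. At `m = 0` both vanish, which is consistent with the cutoff for `a >
0`. -/
theorem plateauFreeSumTerm_top (r n a m : ℕ) :
    plateauFreeSumTerm r n a (n + 1) m = plateauFreeSumTerm r n (a + 1) 0 m := by
  unfold plateauFreeSumTerm
  rcases Nat.eq_zero_or_pos m with rfl | hm
  · rcases Nat.eq_zero_or_pos a with rfl | ha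
    · simp
    · simp [ha.ne']
  · have h1 : a = 0 ∨ 1 ≤ m := Or.inr hm
    have h2 : a + 1 = 0 ∨ 1 ≤ m := Or.inr hm
    rw [if_pos h1, if_pos h2, if_neg (by omega), if_pos rfl]
    simp only [Nat.add_sub_cancel, Nat.sub_self, pow_zero, Nat.cast_add, Nat.cast_one]
    ring

theorem plateauFreeTerm_succ (r n a b m : ℕ) :
    plateauFreeTerm r (n + 1) a b m =
      plateauFreeSumTerm r n a b m - if b = 0 then plateauFreeTerm r n a 0 m else 0 := by
  unfold plateauFreeSumTerm plateauFreeTerm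
  by_cases h1 : a = 0 ∨ 1 ≤ m
  · by_cases h2 : b = 0
    · simp only [h1, h2, if_true]
      ring
    · simp [h1, h2]
  · simp [h1]

/-- Partial sums of the power series with coefficients `plateauFreeTerm`. -/
def plateauFreeSeries (r n M a b : ℕ) : ℝ[X] :=
  (1 - X) * ∑ m ∈ Finset.range M, X ^ m * plateauFreeTerm r n a b m

/-- Partial sums of the power series with coefficients `plateauFreeSumTerm`. -/
def plateauFreeSumSeries (r n M a b : ℕ) : ℝ[X] :=
  (1 - X) * ∑ m ∈ Finset.range M, X ^ m * plateauFreeSumTerm r n a b m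

theorem plateauFreeSumSeries_sub (r n M a : ℕ) {b : ℕ} (hb : b ≤ n) :
    plateauFreeSumSeries r n M a b - plateauFreeSumSeries r n M a (b + 1) =
      (1 - X) * plateauFreeSeries r n M a b := by
  simp only [plateauFreeSumSeries, plateauFreeSeries, ← mul_sub, ← Finset.sum_sub_distrib,
    plateauFreeSumTerm_sub r n a _ hb, Finset.mul_sum]
  exact Finset.sum_congr rfl fun m _ => by ring

theorem plateauFreeSeries_succ (r n M a b : ℕ) :
    plateauFreeSeries r (n + 1) M a b =
      plateauFreeSumSeries r n M a b - if b = 0 then plateauFreeSeries r n M a 0 else 0 := by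
  simp only [plateauFreeSumSeries, plateauFreeSeries, plateauFreeTerm_succ]
  split_ifs <;> simp [mul_sub]

theorem plateauFreeSumSeries_div_mod (r n M a : ℕ) {b : ℕ} (hb : b ≤ n + 1) :
    plateauFreeSumSeries r n M (((n + 1) * a + b) / (n + 1)) (((n + 1) * a + b) % (n + 1)) =
      plateauFreeSumSeries r n M a b := by
  rcases hb.lt_or_eq with h | rfl
  · rw [Nat.mul_add_div (by omega), Nat.div_eq_of_lt h, Nat.mul_add_mod, Nat.mod_eq_of_lt h,
      add_zero]
  · rw [← Nat.mul_succ, Nat.mul_div_cancel_left _ (by omega), Nat.mul_mod_right]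
    simp only [plateauFreeSumSeries, plateauFreeSumTerm_top]

/-- Since `r * (m + 1) - r = r * m`, passing from `a = 0` to `a = r` shifts the summation index,
which multiplies the series by `X` up to its last term. -/
theorem X_pow_dvd_plateauFreeSumSeries {r : ℕ} (hr : 1 ≤ r) (n M : ℕ) :
    X ^ M ∣ plateauFreeSumSeries r n M r 0 - X * plateauFreeSumSeries r n M 0 0 := by
  cases M with
  | zero => simp
  | succ M =>
    have hterm : ∀ m, plateauFreeSumTerm r n r 0 (m + 1) = plateauFreeSumTerm r n 0 0 m := by
      intro m
      simp only [plateauFreeSumTerm, if_true, true_or, le_add_iff_nonneg_left, zero_le, or_true]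
      push_cast
      ring
    have h0 : plateauFreeSumTerm r n r 0 0 = 0 := by
      simp [plateauFreeSumTerm, show r ≠ 0 by omega]
    refine ⟨-((1 - X) * plateauFreeSumTerm r n 0 0 M), ?_⟩
    simp only [plateauFreeSumSeries]
    rw [Finset.sum_range_succ', Finset.sum_range_succ, h0]
    simp only [hterm, pow_succ, mul_add, Finset.mul_sum]
    rw [add_sub_add_comm, ← Finset.sum_sub_distrib, Finset.sum_eq_zero fun m _ => by ring]
    ring

theorem X_pow_dvd_of_dvd_one_sub_X_mul {M : ℕ} {p : ℝ[X]} (h : X ^ M ∣ (1 - X) * p) :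
    X ^ M ∣ p :=
  (IsCoprime.pow_left ⟨1, 1, by ring⟩ : IsCoprime (X ^ M : ℝ[X]) (1 - X)).dvd_of_dvd_mul_left h

theorem X_pow_dvd_plateauFreePolynomial_sub {r : ℕ} (hr : 1 ≤ r) (n M : ℕ) :
    ∀ a b, a < r → b ≤ n → X ^ M ∣
      plateauFreePolynomial r n ((n + 1) * a + b) - plateauFreeSeries r n M a b := by
  induction n with
  | zero =>
    intro a b ha hb
    obtain rfl : b = 0 := by omega
    rcases Nat.eq_zero_or_pos a with rfl | ha0
    · refine ⟨1, ?_⟩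
      have := mul_neg_geom_sum (X : ℝ[X]) M
      simp [plateauFreePolynomial, plateauFreeSeries, plateauFreeTerm, this]
    · cases M with
      | zero => simp
      -- For `a > 0` the series starts at `m = 1`, which accounts for the value `X` in place of 1.
      | succ M =>
        refine ⟨1, ?_⟩
        have := mul_neg_geom_sum (X : ℝ[X]) M
        simp only [plateauFreePolynomial, plateauFreeSeries, plateauFreeTerm, pow_zero]
        rw [Finset.sum_range_succ']
        simp only [pow_succ']
        simp only [ha0.ne', if_true, if_false, false_or, le_add_iff_nonneg_left, zero_le, mul_one,
          nonpos_iff_eq_zero, one_ne_zero, add_zero, mul_zero, zero_add, one_mul, ← Finset.mul_sum]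
        linear_combination (-X) * this
  | succ n ih =>
    set N := (n + 1) * r with hN
    set g : ℕ → ℝ[X] := fun j => plateauFreeSeries r n M (j / (n + 1)) (j % (n + 1)) with hg
    set H : ℕ → ℝ[X] := fun j => plateauFreeSumSeries r n M (j / (n + 1)) (j % (n + 1)) with hH
    have hgQ : ∀ i, i < N → X ^ M ∣ plateauFreePolynomial r n i - g i := by
      intro i hi
      have := ih (i / (n + 1)) (i % (n + 1))
        (by rw [Nat.div_lt_iff_lt_mul (by omega)]; rwa [hN, mul_comm] at hi)
        (by have := Nat.mod_lt i (show 0 < n + 1 by omega); omega)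
      rwa [Nat.div_add_mod] at this
    have hHg : ∀ j, H j - H (j + 1) = (1 - X) * g j := by
      intro j
      have hlt := Nat.mod_lt j (show 0 < n + 1 by omega)
      have h1 := plateauFreeSumSeries_div_mod r n M (j / (n + 1)) (b := j % (n + 1) + 1) (by omega)
      rw [← add_assoc, Nat.div_add_mod] at h1
      simp only [hH, hg, h1]
      exact plateauFreeSumSeries_sub r n M _ (by omega)
    have hsum : ∀ j, j ≤ N → X ^ M ∣
        (1 - X) * ∑ i ∈ Finset.range j, plateauFreePolynomial r n i - (H 0 - H j) := by
      intro j hj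
      rw [← Finset.sum_range_sub', Finset.mul_sum, ← Finset.sum_sub_distrib]
      refine Finset.dvd_sum fun i hi => ?_
      rw [hHg, ← mul_sub]
      exact (hgQ i (by have := Finset.mem_range.1 hi; omega)).mul_left _
    have hH0 : H 0 = plateauFreeSumSeries r n M 0 0 := by simp [hH]
    -- Telescoping over the full range gives `(1 - X) * total ≡ H 0 - H N`, and `H N ≡ X * H 0`; the
    -- factor `1 - X` cancels because it is coprime to `X ^ M`.
    have htotal : X ^ M ∣ ∑ i ∈ Finset.range N, plateauFreePolynomial r n i - H 0 := by
      apply X_pow_dvd_of_dvd_one_sub_X_mul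
      have h1 := hsum N le_rfl
      have h2 := X_pow_dvd_plateauFreeSumSeries hr n M
      have h3 : H N = plateauFreeSumSeries r n M r 0 := by
        have := plateauFreeSumSeries_div_mod r n M r (b := 0) (by omega)
        simpa only [add_zero] using this
      rw [← h3, ← hH0] at h2
      convert h1.sub h2 using 1
      ring
    intro a b ha hb
    have hle : (n + 1) * a + b ≤ N := by rw [hN]; nlinarith
    have hHab : H ((n + 1) * a + b) = plateauFreeSumSeries r n M a b :=
      plateauFreeSumSeries_div_mod r n M a hb
    rw [plateauFreePolynomial_succ hr ha hb, plateauFreeSeries_succ]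
    have h1 := hsum _ hle
    rw [hHab] at h1
    split_ifs with h
    · have h2 := ih a 0 ha (by omega)
      convert (htotal.sub h1).sub h2 using 1
      rw [add_zero]
      ring
    · convert htotal.sub h1 using 1
      ring

theorem eq_of_forall_X_pow_dvd_sub {p q : ℝ[X]} (h : ∀ M, X ^ M ∣ p - q) : p = q := by
  ext k
  have := (X_pow_dvd_iff.1 (h (k + 1))) k k.lt_succ_self
  rwa [coeff_sub, sub_eq_zero] at this

theorem plateauFreePolynomial_zero_eq_derangementPermanent {r : ℕ} (hr : 1 ≤ r) (n : ℕ) :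
    plateauFreePolynomial r n 0 = derangementPermanent r n := by
  refine eq_of_forall_X_pow_dvd_sub fun M => ?_
  have h1 := X_pow_dvd_plateauFreePolynomial_sub hr n M 0 0 hr (by omega)
  have h2 := X_pow_dvd_derangementPermanent_sub r n M
  have h3 : plateauFreeSeries r n M 0 0 = derangementSeries r n M := by
    simp [plateauFreeSeries, derangementSeries, plateauFreeTerm]
  rw [h3] at h1
  simpa using h1.sub h2

/-! ### Vertices and coordinates of the lecture hall simplex -/

theorem Fin.sum_ite_lt_succ_sub_castSucc {n : ℕ} (f : Fin (n + 1) → ℝ) (j : Fin (n + 1)) :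
    ∑ k : Fin n, (if (k : ℕ) < (j : ℕ) then f k.succ - f k.castSucc else 0) = f j - f 0 := by
  induction j using Fin.induction with
  | zero => simp
  | succ j ih =>
    have hsplit : ∀ k : Fin n, (if (k : ℕ) < (j.succ : ℕ) then f k.succ - f k.castSucc else 0) =
        (if (k : ℕ) < (j.castSucc : ℕ) then f k.succ - f k.castSucc else 0) +
          if k = j then f k.succ - f k.castSucc else 0 := by
      intro k
      rcases lt_trichotomy k j with h | h | h
      · have h' : (k : ℕ) < j := h
        simp [h', h.ne, Nat.lt_succ_of_lt h']
      · simp [h]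
      · have h' : (j : ℕ) < k := h
        simp [h.ne', show ¬ (k : ℕ) < j + 1 by omega, h'.not_gt]
    simp_rw [hsplit, Finset.sum_add_distrib, ih]
    simp

/-- The vertices of the `s`-lecture hall simplex. -/
def lectureHallVertex {m : ℕ} (s : Fin m → ℕ) (k : Fin (m + 1)) : Fin m → ℝ :=
  fun i => if (k : ℕ) ≤ i then (s i : ℝ) else 0

/-- The sequence `0, x₁ / s₁, …, xₘ / sₘ, h`. -/
def lectureHallLevel {m : ℕ} (s : Fin m → ℕ) (x : Fin m → ℝ) (h : ℝ) : Fin (m + 2) → ℝ :=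
  Fin.cons 0 (Fin.snoc (fun i => x i / (s i : ℝ)) h)

/-- The coordinates of `(x, h)` in the basis formed by the lifted vertices of the `s`-lecture hall
simplex. -/
def lectureHallCoord {m : ℕ} (s : Fin m → ℕ) (x : Fin m → ℝ) (h : ℝ) (k : Fin (m + 1)) : ℝ :=
  lectureHallLevel s x h k.succ - lectureHallLevel s x h k.castSucc

section Level

variable {m : ℕ} (s : Fin m → ℕ) (x : Fin m → ℝ) (h : ℝ)

@[simp] theorem lectureHallLevel_zero : lectureHallLevel s x h 0 = 0 := by
  simp [lectureHallLevel]

@[simp] theorem lectureHallLevel_last : lectureHallLevel s x h (Fin.last (m + 1)) = h := by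
  rw [← Fin.succ_last]
  simp [lectureHallLevel]

@[simp] theorem lectureHallLevel_castSucc_succ (i : Fin m) :
    lectureHallLevel s x h i.castSucc.succ = x i / (s i : ℝ) := by
  simp [lectureHallLevel]

theorem forall_fin_level {p : Fin (m + 2) → Prop} (h0 : p 0) (h1 : ∀ i : Fin m, p i.castSucc.succ)
    (h2 : p (Fin.last (m + 1))) : ∀ j, p j := by
  intro j
  induction j using Fin.cases with
  | zero => exact h0
  | succ j =>
    induction j using Fin.lastCases with
    | last => exact h2
    | cast i => exact h1 i

theorem lectureHallLevel_affine (x y : Fin m → ℝ) {a b : ℝ} (k : Fin (m + 2)) (h h' : ℝ) :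
    lectureHallLevel s (a • x + b • y) (a * h + b * h') k =
      a * lectureHallLevel s x h k + b * lectureHallLevel s y h' k := by
  revert k
  apply forall_fin_level
  · simp
  · intro i
    simp
    ring
  · simp

theorem lectureHallCoord_affine (x y : Fin m → ℝ) {a b : ℝ} (hab : a + b = 1)
    (k : Fin (m + 1)) :
    lectureHallCoord s (a • x + b • y) 1 k =
      a * lectureHallCoord s x 1 k + b * lectureHallCoord s y 1 k := by
  have := fun k => lectureHallLevel_affine s x y (a := a) (b := b) k 1 1
  simp only [mul_one, hab] at this
  simp only [lectureHallCoord, this]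
  ring

end Level

section Simplex

variable {m : ℕ} {s : Fin m → ℕ}

/-- The vertex with index `k` is supported on the coordinates from `k` on, so `xᵢ / sᵢ` and `h` are
partial sums of the coefficients; differencing inverts this. -/
theorem sum_smul_lectureHallVertex_eq_iff (hs : ∀ i, 0 < s i) (c : Fin (m + 1) → ℝ)
    (x : Fin m → ℝ) (h : ℝ) :
    ∑ k, c k • (lectureHallVertex s k, (1 : ℝ)) = (x, h) ↔ c = lectureHallCoord s x h := by
  have hs' : ∀ i, (s i : ℝ) ≠ 0 := fun i => by exact_mod_cast (hs i).ne'
  have hfst : ∀ i, (∑ k, c k • (lectureHallVertex s k, (1 : ℝ))).1 i =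
      s i * ∑ k : Fin (m + 1), if (k : ℕ) < i.castSucc.succ then c k else 0 := by
    intro i
    simp only [Prod.fst_sum, Prod.smul_mk, Finset.sum_apply, Pi.smul_apply, lectureHallVertex,
      smul_eq_mul, mul_ite, mul_zero, Finset.mul_sum]
    refine Finset.sum_congr rfl fun k _ => ?_
    simp only [Fin.val_succ, Fin.val_castSucc, Nat.lt_succ_iff]
    split_ifs
    · ring
    · rfl
  have hsnd : (∑ k, c k • (lectureHallVertex s k, (1 : ℝ))).2 = ∑ k, c k := by
    simp [Prod.snd_sum]
  rw [Prod.ext_iff, hsnd, funext_iff]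
  simp only [hfst]
  constructor
  · rintro ⟨h1, h2⟩
    have hlevel : ∀ j : Fin (m + 2), lectureHallLevel s x h j =
        ∑ k : Fin (m + 1), if (k : ℕ) < j then c k else 0 := by
      apply forall_fin_level
      · simp
      · intro i
        rw [lectureHallLevel_castSucc_succ, ← h1 i, mul_div_cancel_left₀ _ (hs' i)]
      · rw [lectureHallLevel_last, ← h2]
        refine Finset.sum_congr rfl fun k _ => (if_pos ?_).symm
        exact k.2
    funext j
    rw [lectureHallCoord, hlevel, hlevel, ← Finset.sum_sub_distrib, Finset.sum_eq_single j]
    · simp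
    · intro k _ hk
      have : (k : ℕ) ≠ j := fun h => hk (Fin.ext h)
      simp only [Fin.val_succ, Fin.val_castSucc]
      split_ifs <;> first | omega | simp
    · simp
  · rintro rfl
    constructor
    · intro i
      simp only [lectureHallCoord]
      rw [Fin.sum_ite_lt_succ_sub_castSucc (lectureHallLevel s x h)]
      simp only [lectureHallLevel_castSucc_succ, lectureHallLevel_zero, sub_zero]
      field_simp [hs' i]
    · have := Fin.sum_ite_lt_succ_sub_castSucc (lectureHallLevel s x h) (Fin.last (m + 1))
      simp only [lectureHallLevel_last, lectureHallLevel_zero, sub_zero] at this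
      simp only [lectureHallCoord]
      conv_rhs => rw [← this]
      refine Finset.sum_congr rfl fun k _ => (if_pos ?_).symm
      exact k.2

theorem lectureHallCoord_vertex (hs : ∀ i, 0 < s i) (k : Fin (m + 1)) :
    lectureHallCoord s (lectureHallVertex s k) 1 = Pi.single k 1 := by
  refine ((sum_smul_lectureHallVertex_eq_iff hs _ _ _).1 ?_).symm
  rw [Finset.sum_eq_single k]
  · simp
  · intro j _ hj
    simp [hj]
  · simp

theorem lectureHallVertex_injective (hs : ∀ i, 0 < s i) :
    Function.Injective (lectureHallVertex s) := by
  intro k l hkl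
  have h := lectureHallCoord_vertex hs k
  rw [hkl, lectureHallCoord_vertex hs l] at h
  by_contra hne
  have := congrFun h k
  simp [hne] at this

theorem mem_lectureHallSimplex_iff (x : Fin m → ℝ) :
    x ∈ lectureHallSimplex s ↔ ∀ k, 0 ≤ lectureHallCoord s x 1 k := by
  have hmono : (∀ k, 0 ≤ lectureHallCoord s x 1 k) ↔ Monotone (lectureHallLevel s x 1) := by
    rw [Fin.monotone_iff_le_succ]
    simp [lectureHallCoord]
  rw [hmono]
  constructor
  · rintro ⟨h1, h2, h3⟩
    intro i j
    revert i
    apply forall_fin_level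
    · revert j
      apply forall_fin_level
      · simp
      · intro j _
        simpa using h1 j
      · simp
    · intro i
      revert j
      apply forall_fin_level
      · simp
      · intro j hij
        simpa using h2 i j (by simpa using hij)
      · intro _
        simpa using h3 i
    · intro hj
      rw [Fin.last_le_iff] at hj
      rw [hj]
  · intro h
    refine ⟨fun i => ?_, fun i j hij => ?_, fun i => ?_⟩
    · simpa using h (Fin.zero_le i.castSucc.succ)
    · simpa using h (show i.castSucc.succ ≤ j.castSucc.succ by simpa using hij)
    · simpa using h (Fin.le_last i.castSucc.succ)

theorem convex_lectureHallSimplex : Convex ℝ (lectureHallSimplex s) := by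
  intro x hx y hy a b ha hb hab
  rw [mem_lectureHallSimplex_iff] at *
  intro k
  rw [lectureHallCoord_affine s x y hab]
  exact add_nonneg (mul_nonneg ha (hx k)) (mul_nonneg hb (hy k))

theorem eq_lectureHallVertex_of_coord (hs : ∀ i, 0 < s i) {x : Fin m → ℝ} {k : Fin (m + 1)}
    (h : lectureHallCoord s x 1 = Pi.single k 1) : x = lectureHallVertex s k := by
  have h1 := (sum_smul_lectureHallVertex_eq_iff hs _ x 1).2 h.symm
  have h2 := (sum_smul_lectureHallVertex_eq_iff hs _ _ 1).2 (lectureHallCoord_vertex hs k).symm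
  exact (Prod.ext_iff.1 (h1.symm.trans h2)).1

theorem sum_lectureHallCoord (hs : ∀ i, 0 < s i) (x : Fin m → ℝ) (h : ℝ) :
    ∑ k, lectureHallCoord s x h k = h := by
  have h1 := (sum_smul_lectureHallVertex_eq_iff hs _ x h).2 rfl
  simpa [Prod.snd_sum] using congrArg Prod.snd h1

theorem extremePoints_lectureHallSimplex (hs : ∀ i, 0 < s i) :
    (lectureHallSimplex s).extremePoints ℝ = Set.range (lectureHallVertex s) := by
  have hmem : ∀ k, lectureHallVertex s k ∈ lectureHallSimplex s := by
    intro k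
    rw [mem_lectureHallSimplex_iff, lectureHallCoord_vertex hs]
    intro j
    exact (Pi.single_nonneg.2 zero_le_one : (0 : Fin (m + 1) → ℝ) ≤ Pi.single k 1) j
  apply Set.Subset.antisymm
  · have hhull : lectureHallSimplex s = convexHull ℝ (Set.range (lectureHallVertex s)) := by
      apply Set.Subset.antisymm
      · intro x hx
        rw [mem_lectureHallSimplex_iff] at hx
        have h1 := (sum_smul_lectureHallVertex_eq_iff hs _ x 1).2 rfl
        have h2 : x = ∑ k, lectureHallCoord s x 1 k • lectureHallVertex s k := by
          simpa [Prod.fst_sum] using (congrArg Prod.fst h1).symm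
        rw [h2]
        exact (convex_convexHull ℝ _).sum_mem (fun k _ => hx k) (sum_lectureHallCoord hs x 1)
          fun k _ => subset_convexHull ℝ _ ⟨k, rfl⟩
      · exact convexHull_min (Set.range_subset_iff.2 hmem) convex_lectureHallSimplex
    rw [hhull]
    exact extremePoints_convexHull_subset
  · rintro _ ⟨k, rfl⟩
    refine ⟨hmem k, ?_⟩
    rintro x hx y hy ⟨a, b, ha, hb, hab, hxy⟩
    rw [mem_lectureHallSimplex_iff] at hx hy
    apply eq_lectureHallVertex_of_coord hs
    have hzero : ∀ j, j ≠ k → lectureHallCoord s x 1 j = 0 := by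
      intro j hj
      have h1 := lectureHallCoord_affine s x y hab j
      rw [hxy, lectureHallCoord_vertex hs, Pi.single_eq_of_ne hj] at h1
      have h2 := mul_nonneg ha.le (hx j)
      have h3 := mul_nonneg hb.le (hy j)
      have h4 : a * lectureHallCoord s x 1 j = 0 := by linarith
      exact (mul_eq_zero.1 h4).resolve_left ha.ne'
    funext j
    by_cases hj : j = k
    · subst hj
      have h1 := sum_lectureHallCoord hs x 1
      rw [Finset.sum_eq_single j (fun i _ hi => hzero i hi) (by simp)] at h1
      simp [h1]
    · rw [hzero j hj, Pi.single_eq_of_ne hj]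

theorem mem_openParallelepiped_lectureHallSimplex (hs : ∀ i, 0 < s i) (x : Fin m → ℝ) (h : ℝ) :
    (x, h) ∈ openParallelepiped (lectureHallSimplex s) ↔
      ∀ k, 0 < lectureHallCoord s x h k ∧ lectureHallCoord s x h k < 1 := by
  have hinj := lectureHallVertex_injective hs
  simp only [openParallelepiped, extremePoints_lectureHallSimplex hs, Set.mem_ofPred_eq,
    Set.forall_mem_range, finsum_mem_range hinj, finsum_eq_sum_of_fintype]
  constructor
  · rintro ⟨c, hc, hx⟩
    have := (sum_smul_lectureHallVertex_eq_iff hs (fun k => c (lectureHallVertex s k)) x h).1 hx.symm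
    rwa [← this]
  · intro hc
    refine ⟨Function.extend (lectureHallVertex s) (lectureHallCoord s x h) 0, ?_, ?_⟩
    · simpa only [hinj.extend_apply] using hc
    · simp only [hinj.extend_apply]
      exact ((sum_smul_lectureHallVertex_eq_iff hs _ x h).2 rfl).symm

end Simplex

/-! ### Integer chains counted by ascents -/

/-- The ascent enumerator of inversion sequences for `τ` without plateaus that end in `j` at
position `k`. -/
def ascentPolynomial (τ : ℕ → ℕ) : ℕ → ℕ → ℝ[X]
  | 0, _ => 1
  | k + 1, j => ∑ i ∈ Finset.range (τ k),
      ascentWeight i (τ k) j (τ (k + 1)) * ascentPolynomial τ k i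

/-- Integer sequences `z₀ = 0, …, zₘ = N` for which the consecutive differences of `zₖ / τₖ` lie
strictly between `0` and `1`. -/
def chainSet (τ : ℕ → ℕ) (m : ℕ) (N : ℤ) : Set (Fin (m + 1) → ℤ) :=
  {z | z 0 = 0 ∧ z (Fin.last m) = N ∧ ∀ i : Fin m,
    0 < z i.succ * τ i - z i.castSucc * τ (i + 1) ∧
      z i.succ * τ i - z i.castSucc * τ (i + 1) < τ i * τ (i + 1)}

/-- The coefficient of `X ^ q` in a polynomial, for an integer `q`. -/
def intCoeff (p : ℝ[X]) (q : ℤ) : ℝ := if 0 ≤ q then p.coeff q.toNat else 0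

theorem intCoeff_X_mul (p : ℝ[X]) (q : ℤ) : intCoeff (X * p) q = intCoeff p (q - 1) := by
  unfold intCoeff
  rcases lt_trichotomy q 0 with h | rfl | h
  · rw [if_neg (by omega), if_neg (by omega)]
  · simp
  · obtain ⟨k, rfl⟩ : ∃ k : ℕ, q = k + 1 := ⟨(q - 1).toNat, by omega⟩
    rw [if_pos (by omega), if_pos (by omega), show ((k : ℤ) + 1).toNat = k + 1 by omega,
      show ((k : ℤ) + 1 - 1).toNat = k by omega, coeff_X_mul]

theorem intCoeff_sum {ι : Type*} (s : Finset ι) (p : ι → ℝ[X]) (q : ℤ) :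
    intCoeff (∑ i ∈ s, p i) q = ∑ i ∈ s, intCoeff (p i) q := by
  unfold intCoeff
  split_ifs <;> simp

theorem ncard_biUnion_finset {ι α : Type*} {I : Finset ι} {S : ι → Set α}
    (hfin : ∀ i ∈ I, (S i).Finite) (hdisj : (I : Set ι).PairwiseDisjoint S) :
    (⋃ i ∈ I, S i).ncard = ∑ i ∈ I, (S i).ncard := by
  classical
  induction I using Finset.induction_on with
  | empty => simp
  | insert a I ha ih =>
    rw [Finset.coe_insert, Set.pairwiseDisjoint_insert_of_notMem (by simpa using ha)] at hdisj
    have hfin' : ∀ i ∈ I, (S i).Finite := fun i hi => hfin i (Finset.mem_insert_of_mem hi)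
    rw [Finset.set_biUnion_insert, Finset.sum_insert ha, ← ih hfin' hdisj.1]
    refine Set.ncard_union_eq ?_ (hfin a (Finset.mem_insert_self _ _))
      (I.finite_toSet.biUnion hfin')
    exact Set.disjoint_iUnion₂_right.2 fun i hi => hdisj.2 i hi

/-- Write `N = Q * t - i` with `0 ≤ i < t`. The gap is `(q - Q) * t * t' + (i * t' - j * t)`, whose
second summand is smaller than `t * t'` in absolute value. So `q - Q` is 0 or 1 according to the
sign of that summand, which cannot be 0. -/
theorem exists_residue_of_gap {t t' j : ℕ} (ht : 0 < t) (hj : j < t') (q N : ℤ) :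
    (0 < (q * t' - j) * t - N * t' ∧ (q * t' - j) * t - N * t' < t * t') ↔
      ∃ i, i < t ∧ i * t' ≠ j * t ∧ N = (if i * t' < j * t then q - 1 else q) * t - i := by
  have htz : (0 : ℤ) < t := by exact_mod_cast ht
  have hjz : (j : ℤ) + 1 ≤ t' := by exact_mod_cast hj
  have hjt : (j : ℤ) * t < t * t' := by nlinarith
  have hj0 : (0 : ℤ) ≤ j * t := by positivity
  constructor
  · rintro ⟨h1, h2⟩
    obtain ⟨i, hi⟩ : ∃ i : ℕ, (i : ℤ) = (-N) % t :=
      ⟨((-N) % t).toNat, Int.toNat_of_nonneg (Int.emod_nonneg _ htz.ne')⟩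
    have hit : (i : ℤ) < t := hi ▸ Int.emod_lt_of_pos _ htz
    obtain ⟨Q, hQ⟩ : ∃ Q : ℤ, N = Q * t - i := by
      refine ⟨-((-N) / t), ?_⟩
      have := Int.mul_ediv_add_emod (-N) t
      rw [hi]
      linarith
    have hi0 : (0 : ℤ) ≤ i * t' := by positivity
    have hit' : (i : ℤ) * t' < t * t' := by nlinarith
    have key : (q * t' - j) * t - N * t' = (q - Q) * (t * t') + (i * t' - j * t) := by
      rw [hQ]; ring
    rw [key] at h1 h2
    have hT : (0 : ℤ) < t * t' := by nlinarith
    have hlow : -1 < q - Q := by nlinarith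
    have hhigh : q - Q < 2 := by nlinarith
    refine ⟨i, by exact_mod_cast hit, ?_, ?_⟩
    · intro h
      have h' : (i : ℤ) * t' = j * t := by exact_mod_cast h
      rw [h', sub_self, add_zero] at h1 h2
      have h3 : 0 < q - Q := by nlinarith
      have h4 : q - Q < 1 := by nlinarith
      omega
    · rcases (by omega : q - Q = 0 ∨ q - Q = 1) with h | h
      · rw [h] at h1
        have : ¬ i * t' < j * t := by
          intro hlt
          have : (i : ℤ) * t' < j * t := by exact_mod_cast hlt
          linarith
        rw [if_neg this, hQ]
        congr 2
        omega
      · rw [h] at h2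
        have : i * t' < j * t := by
          have : (i : ℤ) * t' < j * t := by linarith
          exact_mod_cast this
        rw [if_pos this, hQ]
        congr 2
        omega
  · rintro ⟨i, hit, hne, rfl⟩
    have hitz : (i : ℤ) + 1 ≤ t := by exact_mod_cast hit
    have hi0 : (0 : ℤ) ≤ i * t' := by positivity
    have hit' : (i : ℤ) * t' < t * t' := by nlinarith
    split_ifs with h
    · have hz : (i : ℤ) * t' < j * t := by exact_mod_cast h
      constructor <;> linarith
    · have hz : (j : ℤ) * t < i * t' := by
        have : j * t < i * t' := by omega
        exact_mod_cast this
      constructor <;> linarith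

theorem mem_chainSet_succ {τ : ℕ → ℕ} {m : ℕ} {N : ℤ} {z : Fin (m + 2) → ℤ} :
    z ∈ chainSet τ (m + 1) N ↔ z (Fin.last (m + 1)) = N ∧
      (0 < N * τ m - z (Fin.last m).castSucc * τ (m + 1) ∧
        N * τ m - z (Fin.last m).castSucc * τ (m + 1) < τ m * τ (m + 1)) ∧
      Fin.init z ∈ chainSet τ m (z (Fin.last m).castSucc) := by
  simp only [chainSet, Set.mem_ofPred_eq, Fin.forall_fin_succ', Fin.succ_last, Fin.val_last,
    Fin.init, Fin.val_castSucc, Fin.succ_castSucc, Fin.castSucc_zero]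
  constructor
  · rintro ⟨h0, rfl, h1, h2⟩
    exact ⟨rfl, h2, h0, trivial, h1⟩
  · rintro ⟨rfl, h2, h0, -, h1⟩
    exact ⟨h0, rfl, h1, h2⟩

/-- Induction on the length, splitting by the residue of the penultimate entry. An ascent lowers the
quotient by one, matching multiplication by `X`; integer exponents are needed because the quotient
may become negative. -/
theorem finite_chainSet_and_ncard {τ : ℕ → ℕ} (hτ : ∀ k, 0 < τ k) (h0 : τ 0 = 1) (m : ℕ) :
    ∀ (j : ℕ) (q : ℤ), j < τ m → (chainSet τ m (q * τ m - j)).Finite ∧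
      ((chainSet τ m (q * τ m - j)).ncard : ℝ) = intCoeff (ascentPolynomial τ m j) q := by
  induction m with
  | zero =>
    intro j q hj
    obtain rfl : j = 0 := by omega
    have hset : chainSet τ 0 (q * τ 0 - (0 : ℕ)) = if q = 0 then {0} else ∅ := by
      ext z
      simp only [chainSet, h0]
      split_ifs with hq
      · subst hq
        simp only [Set.mem_ofPred_eq, Set.mem_singleton_iff, funext_iff]
        simp
      · simp only [Set.mem_ofPred_eq, Set.mem_empty_iff_false, iff_false]
        rintro ⟨h1, h2, -⟩
        have : z (Fin.last 0) = z 0 := rfl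
        simp at h2
        omega
    rw [hset]
    refine ⟨?_, ?_⟩
    · split_ifs <;> simp
    · split_ifs with hq
      · subst hq
        simp [intCoeff, ascentPolynomial]
      · simp only [intCoeff, ascentPolynomial, coeff_one, Set.ncard_empty]
        split_ifs <;> first | omega | simp
  | succ m ih =>
    intro j q hj
    set N : ℤ := q * τ (m + 1) - j with hN
    set I := (Finset.range (τ m)).filter fun i => i * τ (m + 1) ≠ j * τ m with hI
    set Q : ℕ → ℤ := fun i => if i * τ (m + 1) < j * τ m then q - 1 else q with hQ
    have hfin : ∀ i ∈ I, (chainSet τ m (Q i * τ m - i)).Finite := fun i hi =>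
      (ih i (Q i) (Finset.mem_range.1 (Finset.mem_filter.1 hi).1)).1
    set S : ℕ → Set (Fin (m + 2) → ℤ) := fun i =>
      (fun z : Fin (m + 1) → ℤ => (Fin.snoc z N : Fin (m + 2) → ℤ)) ''
        chainSet τ m (Q i * τ m - i) with hS
    have hinj : Function.Injective
        (fun z : Fin (m + 1) → ℤ => (Fin.snoc z N : Fin (m + 2) → ℤ)) := by
      intro z w h
      have := congrArg Fin.init h
      simpa using this
    have hset : chainSet τ (m + 1) N = ⋃ i ∈ I, S i := by
      ext z
      simp only [Set.mem_iUnion, exists_prop, hS, Set.mem_image]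
      rw [mem_chainSet_succ, exists_residue_of_gap (hτ m) hj]
      constructor
      · rintro ⟨h1, ⟨i, hi, hne, hz⟩, h2⟩
        refine ⟨i, by simp [hI, hi, hne], Fin.init z, ?_, ?_⟩
        · rwa [hz] at h2
        · rw [← h1]
          exact Fin.snoc_init_self z
      · rintro ⟨i, hi, w, hw, rfl⟩
        have hlast : w (Fin.last m) = Q i * τ m - i := hw.2.1
        have hi' := Finset.mem_filter.1 hi
        simp only [Fin.snoc_last, Fin.snoc_castSucc, Fin.init_snoc, true_and, hlast]
        exact ⟨⟨i, Finset.mem_range.1 hi'.1, hi'.2, rfl⟩, hw⟩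
    have hfinS : ∀ i ∈ I, (S i).Finite := fun i hi => (hfin i hi).image _
    have hdisj : (I : Set ℕ).PairwiseDisjoint S := by
      intro i hi i' hi' hne
      refine Set.disjoint_left.2 ?_
      rintro _ ⟨w, hw, rfl⟩ ⟨w', hw', h⟩
      have hww : w' = w := hinj h
      subst hww
      have heq : Q i * τ m - i = Q i' * τ m - i' := hw.2.1.symm.trans hw'.2.1
      have h1 := Finset.mem_range.1 (Finset.mem_filter.1 hi).1
      have h2 := Finset.mem_range.1 (Finset.mem_filter.1 hi').1
      apply hne
      have h3 : ((i : ℤ)) ≡ i' [ZMOD τ m] := by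
        rw [Int.modEq_iff_dvd]
        exact ⟨Q i' - Q i, by linarith⟩
      have h4 := (Int.natCast_modEq_iff).1 h3
      exact Nat.ModEq.eq_of_lt_of_lt h4 h1 h2
    refine ⟨?_, ?_⟩
    · rw [hset]
      exact I.finite_toSet.biUnion hfinS
    · rw [hset, ncard_biUnion_finset hfinS hdisj]
      push_cast
      rw [ascentPolynomial, intCoeff_sum, hI, Finset.sum_filter]
      refine Finset.sum_congr rfl fun i hi => ?_
      have hcard : ((S i).ncard : ℝ) = intCoeff (ascentPolynomial τ m i) (Q i) := by
        rw [← (ih i (Q i) (Finset.mem_range.1 hi)).2, hS, Set.ncard_image_of_injective _ hinj]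
      rw [hcard]
      simp only [ascentWeight, hQ]
      rcases lt_trichotomy (i * τ (m + 1)) (j * τ m) with h | h | h
      · simp [h, h.ne, intCoeff_X_mul]
      · simp [h, intCoeff]
      · simp [h, h.ne', h.not_gt]

/-! ### Box points as chains, and the symmetry of the box polynomial -/

/-- The sequence `1, s₁, …, sₘ, 1, 1, …`. -/
def extendByOne {m : ℕ} (s : Fin m → ℕ) (k : ℕ) : ℕ :=
  if h : k - 1 < m then if k = 0 then 1 else s ⟨k - 1, h⟩ else 1

section Box

variable {m : ℕ} {s : Fin m → ℕ}

theorem extendByOne_pos (hs : ∀ i, 0 < s i) (k : ℕ) : 0 < extendByOne s k := by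
  unfold extendByOne
  split_ifs <;> simp [hs]

@[simp] theorem extendByOne_zero : extendByOne s 0 = 1 := by
  simp [extendByOne]

@[simp] theorem extendByOne_succ (i : Fin m) : extendByOne s (i + 1) = s i := by
  simp [extendByOne]

@[simp] theorem extendByOne_last : extendByOne s (m + 1) = 1 := by
  simp [extendByOne]

theorem lectureHallLevel_intCast (x : Fin m → ℤ) (h : ℤ) (k : Fin (m + 2)) :
    lectureHallLevel s (fun i => (x i : ℝ)) h k =
      ((Fin.cons 0 (Fin.snoc x h) : Fin (m + 2) → ℤ) k : ℝ) / extendByOne s k := by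
  revert k
  apply forall_fin_level
  · simp
  · intro i
    rw [lectureHallLevel_castSucc_succ]
    simp
  · rw [lectureHallLevel_last, ← Fin.succ_last]
    simp

theorem mem_boxPoints_iff (hs : ∀ i, 0 < s i) (x : Fin m → ℤ) (h : ℤ) :
    (x, h) ∈ boxPoints (lectureHallSimplex s) ↔
      (Fin.cons 0 (Fin.snoc x h) : Fin (m + 2) → ℤ) ∈ chainSet (extendByOne s) (m + 1) h := by
  have hlast : (Fin.cons 0 (Fin.snoc x h) : Fin (m + 2) → ℤ) (Fin.last (m + 1)) = h := by
    rw [← Fin.succ_last]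
    simp
  simp only [boxPoints, Set.mem_ofPred_eq, mem_openParallelepiped_lectureHallSimplex hs,
    lectureHallCoord, lectureHallLevel_intCast, chainSet, hlast, Fin.cons_zero, true_and]
  refine forall_congr' fun k => ?_
  have h1 : (0 : ℝ) < extendByOne s k := by exact_mod_cast extendByOne_pos hs k
  have h2 : (0 : ℝ) < extendByOne s (k + 1) := by exact_mod_cast extendByOne_pos hs (k + 1)
  rw [Fin.val_succ, Fin.val_castSucc, div_sub_div _ _ h2.ne' h1.ne',
    div_pos_iff_of_pos_right (mul_pos h2 h1), div_lt_one (mul_pos h2 h1)]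
  generalize (Fin.cons 0 (Fin.snoc x h) : Fin (m + 2) → ℤ) k.succ = a
  generalize (Fin.cons 0 (Fin.snoc x h) : Fin (m + 2) → ℤ) k.castSucc = b
  rw [mul_comm (extendByOne s (k + 1) : ℝ) (b : ℝ), mul_comm (extendByOne s (k + 1) : ℝ)]
  norm_cast

theorem pos_of_mem_chainSet {τ : ℕ → ℕ} (hτ : ∀ k, 0 < τ k) {n : ℕ} {N : ℤ}
    {z : Fin (n + 2) → ℤ} (hz : z ∈ chainSet τ (n + 1) N) : 0 < N := by
  have hnonneg : ∀ k, 0 ≤ z k := by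
    intro k
    induction k using Fin.induction with
    | zero => exact hz.1.ge
    | succ k ih =>
      have h1 := (hz.2.2 k).1
      have h2 : (0 : ℤ) < τ k := by exact_mod_cast hτ k
      have h3 : (0 : ℤ) < τ (k + 1) := by exact_mod_cast hτ (k + 1)
      have h4 : (0 : ℤ) < z k.succ * τ k := by nlinarith
      exact (pos_of_mul_pos_left h4 h2.le).le
  have h1 := (mem_chainSet_succ.1 hz).2.1.1
  have h2 : (0 : ℤ) < τ n := by exact_mod_cast hτ n
  have h3 : (0 : ℤ) < τ (n + 1) := by exact_mod_cast hτ (n + 1)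
  have h4 := hnonneg (Fin.last n).castSucc
  have h5 : (0 : ℤ) < N * τ n := by nlinarith
  exact pos_of_mul_pos_left h5 h2.le

/-- Subtracting `z k / τ k` from `k` replaces every gap by its complement to 1. On the
parallelepiped this is `λ ↦ 1 - λ`, the source of both symmetries. -/
theorem reflect_mem_chainSet {τ : ℕ → ℕ} {n : ℕ} {N : ℤ} {z : Fin (n + 1) → ℤ}
    (hz : z ∈ chainSet τ n N) :
    (fun k : Fin (n + 1) => (k : ℤ) * τ k - z k) ∈ chainSet τ n (n * τ n - N) := by
  obtain ⟨h0, h1, h2⟩ := hz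
  refine ⟨by simp [h0], by simp [h1], fun i => ?_⟩
  have h3 := h2 i
  simp only [Fin.val_succ, Fin.val_castSucc]
  push_cast
  constructor <;> nlinarith

theorem ncard_chainSet_reflect {τ : ℕ → ℕ} {n : ℕ} (N : ℤ) :
    (chainSet τ n (n * τ n - N)).ncard = (chainSet τ n N).ncard := by
  have hinv : Function.Involutive
      (fun (z : Fin (n + 1) → ℤ) (k : Fin (n + 1)) => (k : ℤ) * τ k - z k) := by
    intro z
    funext k
    simp
  rw [← Set.ncard_image_of_injective (chainSet τ n N) hinv.injective]
  congr 1
  apply Set.Subset.antisymm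
  · intro z hz
    refine ⟨_, ?_, hinv z⟩
    simpa using reflect_mem_chainSet hz
  · rintro _ ⟨z, hz, rfl⟩
    exact reflect_mem_chainSet hz

theorem finite_chainSet_extendByOne (hs : ∀ i, 0 < s i) (N : ℤ) :
    (chainSet (extendByOne s) (m + 1) N).Finite := by
  have := (finite_chainSet_and_ncard (extendByOne_pos hs) extendByOne_zero (m + 1) 0 N
    (by simp)).1
  simpa using this

theorem ncard_chainSet_extendByOne (hs : ∀ i, 0 < s i) (k : ℕ) :
    ((chainSet (extendByOne s) (m + 1) k).ncard : ℝ) =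
      (ascentPolynomial (extendByOne s) (m + 1) 0).coeff k := by
  have := (finite_chainSet_and_ncard (extendByOne_pos hs) extendByOne_zero (m + 1) 0 k
    (by simp)).2
  simpa [intCoeff] using this

theorem snd_mem_of_mem_boxPoints (hs : ∀ i, 0 < s i) {p : (Fin m → ℤ) × ℤ}
    (hp : p ∈ boxPoints (lectureHallSimplex s)) : 0 < p.2 ∧ p.2 ≤ m := by
  have h1 := (mem_boxPoints_iff hs p.1 p.2).1 hp
  have h2 := pos_of_mem_chainSet (extendByOne_pos hs) h1
  -- The upper bound on the height is positivity of the reflected height `m + 1 - h`.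
  have h3 := pos_of_mem_chainSet (extendByOne_pos hs) (reflect_mem_chainSet h1)
  simp only [extendByOne_last] at h3
  push_cast at h3
  exact ⟨h2, by omega⟩

theorem cons_snoc_injective :
    Function.Injective fun p : (Fin m → ℤ) × ℤ => (Fin.cons 0 (Fin.snoc p.1 p.2) : Fin (m + 2) → ℤ) := by
  rintro ⟨x, h⟩ ⟨y, h'⟩ heq
  have h1 := (Fin.cons_injective2 heq).2
  have h2 := Fin.snoc_injective2 h1
  exact Prod.ext h2.1 h2.2

theorem image_boxPoints_snd_eq (hs : ∀ i, 0 < s i) (h : ℤ) :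
    (fun p : (Fin m → ℤ) × ℤ => (Fin.cons 0 (Fin.snoc p.1 p.2) : Fin (m + 2) → ℤ)) ''
      {p | p ∈ boxPoints (lectureHallSimplex s) ∧ p.2 = h} =
      chainSet (extendByOne s) (m + 1) h := by
  apply Set.Subset.antisymm
  · rintro _ ⟨p, ⟨hp, rfl⟩, rfl⟩
    exact (mem_boxPoints_iff hs p.1 p.2).1 hp
  · intro z hz
    have hz' : (Fin.cons 0 (Fin.snoc (Fin.init (Fin.tail z)) h) : Fin (m + 2) → ℤ) = z := by
      have h1 : h = Fin.tail z (Fin.last m) := by rw [← hz.2.1]; rfl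
      rw [h1, Fin.snoc_init_self, ← hz.1, Fin.cons_self_tail]
    refine ⟨(Fin.init (Fin.tail z), h), ⟨?_, rfl⟩, hz'⟩
    rw [mem_boxPoints_iff hs, hz']
    exact hz

theorem finite_boxPoints (hs : ∀ i, 0 < s i) : (boxPoints (lectureHallSimplex s)).Finite := by
  refine ((Finset.Icc (0 : ℤ) m).finite_toSet.biUnion fun h _ => ?_).subset (fun p hp => ?_)
    (s := ⋃ h ∈ ((Finset.Icc (0 : ℤ) m : Finset ℤ) : Set ℤ),
      {p | p ∈ boxPoints (lectureHallSimplex s) ∧ p.2 = h})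
  · refine Set.Finite.of_finite_image ?_ cons_snoc_injective.injOn
    rw [image_boxPoints_snd_eq hs]
    exact finite_chainSet_extendByOne hs h
  · have := snd_mem_of_mem_boxPoints hs hp
    simp only [Set.mem_iUnion, exists_prop]
    exact ⟨p.2, by simp only [Finset.coe_Icc, Set.mem_Icc]; omega, hp, rfl⟩

theorem coeff_sDerangementPolynomial (hs : ∀ i, 0 < s i) (k : ℕ) :
    (sDerangementPolynomial s).coeff k =
      ((chainSet (extendByOne s) (m + 1) k).ncard : ℝ) := by
  classical
  rw [sDerangementPolynomial, boxPolynomial, finsum_mem_eq_finite_toFinset_sum _ (finite_boxPoints hs),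
    finsetSum_coeff]
  simp only [coeff_X_pow]
  rw [Finset.sum_boole, ← image_boxPoints_snd_eq hs,
    Set.ncard_image_of_injective _ cons_snoc_injective, ← Set.ncard_coe_finset]
  congr 2
  ext p
  simp only [Finset.coe_filter, Set.Finite.mem_toFinset, Set.mem_ofPred_eq]
  refine and_congr_right fun hp => ?_
  have := snd_mem_of_mem_boxPoints hs hp
  omega

theorem sDerangementPolynomial_eq_ascentPolynomial (hs : ∀ i, 0 < s i) :
    sDerangementPolynomial s = ascentPolynomial (extendByOne s) (m + 1) 0 := by
  ext k
  rw [coeff_sDerangementPolynomial hs, ncard_chainSet_extendByOne hs]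

theorem coeff_sDerangementPolynomial_eq_zero (hs : ∀ i, 0 < s i) {k : ℕ}
    (hk : k = 0 ∨ m < k) : (sDerangementPolynomial s).coeff k = 0 := by
  rw [coeff_sDerangementPolynomial hs, Nat.cast_eq_zero]
  have hempty : {p | p ∈ boxPoints (lectureHallSimplex s) ∧ p.2 = k} = ∅ := by
    rw [Set.eq_empty_iff_forall_notMem]
    rintro p ⟨hp, hpk⟩
    have := snd_mem_of_mem_boxPoints hs hp
    omega
  rw [← image_boxPoints_snd_eq hs, hempty, Set.image_empty, Set.ncard_empty]

theorem coeff_sDerangementPolynomial_reflect (hs : ∀ i, 0 < s i) {k : ℕ} (hk : k ≤ m + 1) :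
    (sDerangementPolynomial s).coeff (m + 1 - k) = (sDerangementPolynomial s).coeff k := by
  rw [coeff_sDerangementPolynomial hs, coeff_sDerangementPolynomial hs,
    ← ncard_chainSet_reflect (k : ℤ), extendByOne_last]
  congr 3
  push_cast [hk]
  ring

end Box

/-! ### Symmetric decompositions -/

theorem IsSymmetricDecomposition.unique {d : ℕ} {p a b a' b' : ℝ[X]}
    (h : IsSymmetricDecomposition d p a b) (h' : IsSymmetricDecomposition d p a' b') :
    a = a' ∧ b = b' := by
  have hA : ∀ k, d < k → a.coeff k - a'.coeff k = 0 := fun k hk => by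
    rw [(degree_le_iff_coeff_zero _ _).1 h.degree_left k (by exact_mod_cast hk),
      (degree_le_iff_coeff_zero _ _).1 h'.degree_left k (by exact_mod_cast hk), sub_zero]
  have hB : ∀ k, d ≤ k → b.coeff k - b'.coeff k = 0 := fun k hk => by
    rw [(degree_lt_iff_coeff_zero _ _).1 h.degree_right k hk,
      (degree_lt_iff_coeff_zero _ _).1 h'.degree_right k hk, sub_zero]
  have hAr : ∀ k, k ≤ d → a.coeff (d - k) - a'.coeff (d - k) = a.coeff k - a'.coeff k := by
    intro k hk
    conv_rhs => rw [← h.symm_left, ← h'.symm_left]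
    rw [coeff_reflect, coeff_reflect, revAt_le hk]
  have hBr : ∀ k, k ≤ d - 1 →
      b.coeff (d - 1 - k) - b'.coeff (d - 1 - k) = b.coeff k - b'.coeff k := by
    intro k hk
    conv_rhs => rw [← h.symm_right, ← h'.symm_right]
    rw [coeff_reflect, coeff_reflect, revAt_le hk]
  have heq : a + X * b = a' + X * b' := h.eq_add.symm.trans h'.eq_add
  have h0 : a.coeff 0 - a'.coeff 0 = 0 := by
    have := congrArg (fun q => coeff q 0) heq
    simp only [coeff_add, coeff_X_mul_zero] at this
    linarith
  have hs : ∀ k, a.coeff (k + 1) - a'.coeff (k + 1) = -(b.coeff k - b'.coeff k) := by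
    intro k
    have := congrArg (fun q => coeff q (k + 1)) heq
    simp only [coeff_add, coeff_X_mul] at this
    linarith
  -- For the coefficient differences, `b_k = b_{d-1-k} = -a_{d-k} = -a_k`; with `a_{k+1} = -b_k`
  -- this propagates vanishing from the constant term upward.
  have hstep : ∀ k, a.coeff k - a'.coeff k = 0 → b.coeff k - b'.coeff k = 0 := by
    intro k hk
    rcases le_or_gt d k with hdk | hdk
    · exact hB k hdk
    · rw [← hBr k (by omega), ← neg_eq_zero, ← hs, show d - 1 - k + 1 = d - k by omega,
        hAr k hdk.le, hk]
  have hall : ∀ k, a.coeff k - a'.coeff k = 0 := by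
    intro k
    induction k with
    | zero => exact h0
    | succ k ih => rw [hs, hstep k ih, neg_zero]
  exact ⟨ext fun k => sub_eq_zero.1 (hall k), ext fun k => sub_eq_zero.1 (hstep k (hall k))⟩

/-- The box polynomials are symmetric with respect to `m + 1` and `m + 2`; dividing the second by
`X` lowers its symmetry degree by two, to `m`. -/
theorem isSymmetricDecomposition_of_sDerangementPolynomial {m : ℕ} {s : Fin m → ℕ}
    {t : Fin (m + 1) → ℕ} (hs : ∀ i, 0 < s i) (ht : ∀ i, 0 < t i) {p b : ℝ[X]}
    (hp : sDerangementPolynomial s + sDerangementPolynomial t = p)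
    (hb : sDerangementPolynomial t = X * b) :
    IsSymmetricDecomposition (m + 1) p (sDerangementPolynomial s) b := by
  have hcoeff : ∀ k, b.coeff k = (sDerangementPolynomial t).coeff (k + 1) := by
    intro k
    rw [hb, coeff_X_mul]
  refine ⟨by rw [← hp, hb], ?_, ?_, ?_, ?_⟩
  · rw [degree_le_iff_coeff_zero]
    intro k hk
    have hk' : m + 1 < k := by exact_mod_cast hk
    exact coeff_sDerangementPolynomial_eq_zero hs (Or.inr (by omega))
  · refine (degree_lt_iff_coeff_zero _ _).2 fun k hk => ?_
    rw [hcoeff]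
    exact coeff_sDerangementPolynomial_eq_zero ht (Or.inr (by omega))
  · ext k
    rw [coeff_reflect]
    rcases le_or_gt k (m + 1) with hk | hk
    · rw [revAt_le hk, coeff_sDerangementPolynomial_reflect hs hk]
    · rw [revAt_eq_self_of_lt hk]
  · ext k
    rw [coeff_reflect, Nat.add_sub_cancel]
    rcases le_or_gt k m with hk | hk
    · rw [revAt_le hk, hcoeff, hcoeff,
        ← coeff_sDerangementPolynomial_reflect ht (show k + 1 ≤ m + 1 + 1 by omega)]
      congr 1
      omega
    · rw [revAt_eq_self_of_lt hk]

/-! ### Gluing the two box polynomials -/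

theorem extendByOne_of_lt {m : ℕ} (s : Fin m → ℕ) {k : ℕ} (hk : k < m) :
    extendByOne s (k + 1) = s ⟨k, hk⟩ := by
  simp [extendByOne, hk]

/-- The final zero has bound 1 in a box polynomial but `(m + 2) * r` in `plateauFreePolynomial`;
this makes the two agree. -/
theorem ascentWeight_zero_right (i t : ℕ) {t' t'' : ℕ} (h' : 0 < t') (h'' : 0 < t'') :
    ascentWeight i t 0 t' = ascentWeight i t 0 t'' := by
  simp [ascentWeight, h', h'']

theorem ascentWeight_zero_left {t t' : ℕ} (ht : 0 < t) (j : ℕ) :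
    ascentWeight 0 t j t' = if j = 0 then 0 else X := by
  rcases Nat.eq_zero_or_pos j with rfl | hj
  · simp [ascentWeight]
  · simp [ascentWeight, hj, ht, hj.ne']

theorem ascentPolynomial_one {τ : ℕ → ℕ} (h0 : τ 0 = 1) (j : ℕ) :
    ascentPolynomial τ 1 j = if j = 0 then 0 else X := by
  simp [ascentPolynomial, h0, ascentWeight_zero_left]

section Progression

variable {m r : ℕ}

/-- Separates the sequences with first entry 0. Their next entry `j` is then compared with 0, as if
it were itself the first entry after the initial zero of a shorter sequence. -/
theorem sum_ascentWeight_mul_split (hr : 1 ≤ r) {f : ℕ → ℝ[X]}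
    (hf : ∀ i, f i = if i = 0 then 0 else X)
    (j t' : ℕ) :
    ∑ i ∈ Finset.range r, ascentWeight i r j t' * (if i = 0 then 1 else X) =
      ∑ i ∈ Finset.range r, ascentWeight i r j t' * f i + if j = 0 then 0 else X := by
  have hsplit : ∀ i, ascentWeight i r j t' * (if i = 0 then 1 else X) =
      ascentWeight i r j t' * f i + if i = 0 then (if j = 0 then 0 else X) else 0 := by
    intro i
    rw [hf]
    split_ifs with h1 h2
    · subst h1 h2
      simp [ascentWeight]
    · subst h1
      simp [ascentWeight_zero_left hr, h2]
    · simp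
  simp_rw [hsplit, Finset.sum_add_distrib]
  simp [show 0 < r from hr]

/-- After the first entry all three families have the same bounds and hence the same linear transfer
recurrence, so only the base case carries content. -/
theorem ascentPolynomial_add_ascentPolynomial (hr : 1 ≤ r) {k : ℕ} (hk : k + 1 ≤ m) (j : ℕ) :
    ascentPolynomial (extendByOne fun i : Fin m => ((i : ℕ) + 2) * r) (k + 1) j +
      ascentPolynomial (extendByOne fun i : Fin (m + 1) => ((i : ℕ) + 1) * r) (k + 2) j =
      plateauFreePolynomial r (k + 1) j := by
  induction k generalizing j with
  | zero =>
    rw [ascentPolynomial_one extendByOne_zero, ascentPolynomial, plateauFreePolynomial,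
      extendByOne_of_lt _ (show 0 < m + 1 by omega), extendByOne_of_lt _ (show 1 < m + 1 by omega)]
    simp only [zero_add, one_mul, plateauFreePolynomial]
    rw [sum_ascentWeight_mul_split hr (ascentPolynomial_one extendByOne_zero), add_comm]
  | succ k ih =>
    rw [ascentPolynomial, ascentPolynomial, plateauFreePolynomial,
      extendByOne_of_lt _ (show k < m by omega), extendByOne_of_lt _ (show k + 1 < m by omega),
      extendByOne_of_lt _ (show k + 1 < m + 1 by omega),
      extendByOne_of_lt _ (show k + 1 + 1 < m + 1 by omega)]
    simp only [← ih (by omega), mul_add, Finset.sum_add_distrib]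

theorem sDerangementPolynomial_add_eq_plateauFreePolynomial (hr : 1 ≤ r) :
    sDerangementPolynomial (fun i : Fin m => ((i : ℕ) + 2) * r) +
      sDerangementPolynomial (fun i : Fin (m + 1) => ((i : ℕ) + 1) * r) =
      plateauFreePolynomial r (m + 1) 0 := by
  rw [sDerangementPolynomial_eq_ascentPolynomial (fun i => by positivity),
    sDerangementPolynomial_eq_ascentPolynomial (fun i => by positivity)]
  have hpos : 0 < (m + 2) * r := by positivity
  cases m with
  | zero =>
    rw [ascentPolynomial_one extendByOne_zero, ascentPolynomial, plateauFreePolynomial,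
      extendByOne_of_lt _ (show 0 < 0 + 1 by omega), extendByOne_last]
    simp only [zero_add, one_mul, plateauFreePolynomial]
    rw [sum_ascentWeight_mul_split hr (ascentPolynomial_one
      (extendByOne_zero (s := fun i : Fin (0 + 1) => ((i : ℕ) + 1) * r))), add_comm]
    simp only [ascentWeight_zero_right _ _ one_pos (show 0 < 2 * r by omega)]
  | succ m =>
    rw [ascentPolynomial, ascentPolynomial, plateauFreePolynomial, extendByOne_last,
      extendByOne_last, extendByOne_of_lt _ (show m < m + 1 by omega),
      extendByOne_of_lt _ (show m + 1 < m + 1 + 1 by omega)]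
    simp only [ascentWeight_zero_right _ _ one_pos hpos,
      ← ascentPolynomial_add_ascentPolynomial hr (show m + 1 ≤ m + 1 from le_rfl), mul_add,
      Finset.sum_add_distrib]

theorem sDerangementPolynomial_add_eq_coloredDerangementPolynomial (hr : 1 ≤ r) :
    sDerangementPolynomial (fun i : Fin m => ((i : ℕ) + 2) * r) +
      sDerangementPolynomial (fun i : Fin (m + 1) => ((i : ℕ) + 1) * r) =
      coloredDerangementPolynomial (m + 1) r := by
  rw [sDerangementPolynomial_add_eq_plateauFreePolynomial hr,
    plateauFreePolynomial_zero_eq_derangementPermanent hr,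
    coloredDerangementPolynomial_eq_sum_prod _ _ hr, derangementPermanent]

end Progression
end

theorem mainTheorem3 (n r : ℕ) (hn : 1 ≤ n) (hr : 1 ≤ r) :
    sDerangementPolynomial (fun i : Fin (n - 1) => ((i : ℕ) + 2) * r) +
        sDerangementPolynomial (fun i : Fin n => ((i : ℕ) + 1) * r) =
      coloredDerangementPolynomial n r ∧
    ∃ b : ℝ[X],
      sDerangementPolynomial (fun i : Fin n => ((i : ℕ) + 1) * r) = X * b ∧
      IsSymmetricDecomposition n (coloredDerangementPolynomial n r)
        (sDerangementPolynomial (fun i : Fin (n - 1) => ((i : ℕ) + 2) * r)) b ∧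
      ∀ a' b' : ℝ[X],
        IsSymmetricDecomposition n (coloredDerangementPolynomial n r) a' b' →
          a' = sDerangementPolynomial (fun i : Fin (n - 1) => ((i : ℕ) + 2) * r) ∧ b' = b := by
  obtain ⟨m, rfl⟩ : ∃ m, n = m + 1 := ⟨n - 1, by omega⟩
  rw [Nat.add_sub_cancel]
  have hsum := sDerangementPolynomial_add_eq_coloredDerangementPolynomial (m := m) hr
  obtain ⟨b, hb⟩ : (X : ℝ[X]) ∣
      sDerangementPolynomial (fun i : Fin (m + 1) => ((i : ℕ) + 1) * r) :=
    X_dvd_iff.2 (coeff_sDerangementPolynomial_eq_zero (fun i => by positivity) (Or.inl rfl))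
  have hdec := isSymmetricDecomposition_of_sDerangementPolynomial
    (fun i => by positivity) (fun i => by positivity) hsum hb
  exact ⟨hsum, b, hb, hdec, fun a' b' h => h.unique hdec⟩
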